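/- Let $T$ be an abelian topological group, and let $\{(\varphi_i, X_i)\}_{i \in I}$ be a family of topological group compactifications of $T$; that is, each $X_i$ is a compact Hausdorff topological group and $\varphi_i \colon T \to X_i$ is a continuous homomorphism with dense image. Each $X_i$ is regarded as a minimal $T$-flow with the action $t x = \varphi_i(t) x$ for $t \in T$, $x \in X_i$. For a topological group $G$, let $\widehat{G}$ be the group of continuous homomorphisms from $G$ to the circle group, and let $A_i = \varphi_i^{*}(\widehat{X_i}) = \{\chi \circ \varphi_i : \chi \in \widehat{X_i}\}$, a subgroup of $\widehat{T}$. Then the following are equivalent: 1. the family $\{X_i\}_{i \in I}$ is multiply disjoint, i.e. the product flow $\prod_{i \in I} X_i$ with the coordinatewise action of $T$ is minimal (every $T$-orbit is dense); 2. the family $\{A_i\}_{i \in I}$ of subgroups of $\widehat{T}$ is independent, i.e. whenever $J \subseteq I$ is non-empty and finite, $h_j \in A_j$ for $j \in J$, and $\prod_{j \in J} h_j = 1$, then $h_j = 1$ for all $j \in J$. -/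

import Mathlib

universe u v w

namespace TopDyn

/-- A topological group compactification `(φ, X)` of a topological group `T`: a compact Hausdorff
topological group `X` with a continuous homomorphism `φ : T → X` whose image is dense. -/
structure GroupCompactification (T : Type u) [Group T] [TopologicalSpace T] where
  /-- The underlying space `X`. -/
  carrier : Type v
  [group : Group carrier]
  [topology : TopologicalSpace carrier]
  [isTopologicalGroup : IsTopologicalGroup carrier]
  [compact : CompactSpace carrier]
  [hausdorff : T2Space carrier]
  /-- The homomorphism `φ`. -/
  hom : T →ₜ* carrier
  dense : DenseRange hom

namespace GroupCompactification

attribute [instance] group topology isTopologicalGroup compact hausdorff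

variable {T : Type u} [Group T] [TopologicalSpace T]

/-- The `T`-flow of a group compactification: `t • x = φ t * x`. -/
instance mulAction (K : GroupCompactification.{u, v} T) : MulAction T K.carrier :=
  MulAction.compHom K.carrier (K.hom : T →* K.carrier)

theorem smul_def (K : GroupCompactification.{u, v} T) (t : T) (x : K.carrier) :
    t • x = K.hom t * x :=
  rfl

instance continuousSMul (K : GroupCompactification.{u, v} T) : ContinuousSMul T K.carrier :=
  ⟨((map_continuous K.hom).comp continuous_fst).mul continuous_snd⟩

/-- The flow of a group compactification is minimal. -/
instance isMinimal (K : GroupCompactification.{u, v} T) : MulAction.IsMinimal T K.carrier :=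
  ⟨fun x => (mul_right_surjective x).denseRange.comp K.dense (continuous_mul_const x)⟩

/-- The subgroup `φ^*(X^)` of the character group of `T`: all the characters `χ ∘ φ` of `T` with
`χ` a (continuous, circle-valued) character of `X`. -/
noncomputable def characters (K : GroupCompactification.{u, v} T) : Subgroup (PontryaginDual T) :=
  (PontryaginDual.map K.hom).toMonoidHom.range

end GroupCompactification

/-- A family of minimal `T`-flows (continuous actions of `T` on compact Hausdorff spaces with every
orbit dense) is multiply disjoint if the product flow, on which `T` acts coordinatewise, is
minimal. -/
def MultiplyDisjoint (T : Type u) [Group T] [TopologicalSpace T] {I : Type w} (X : I → Type v)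
    [∀ i, TopologicalSpace (X i)] [∀ i, CompactSpace (X i)] [∀ i, T2Space (X i)]
    [∀ i, MulAction T (X i)] [∀ i, ContinuousSMul T (X i)]
    [∀ i, MulAction.IsMinimal T (X i)] : Prop :=
  MulAction.IsMinimal T (∀ i, X i)

/-- A family of subgroups of an abelian group is independent if a product of elements
`h j ∈ H j`, over a non-empty finite set of indices `j`, is the identity only if every `h j` is. -/
def IndependentSubgroups {G : Type u} [CommGroup G] {I : Type w} (H : I → Subgroup G) : Prop :=
  ∀ J : Finset I, J.Nonempty → ∀ h : I → G, (∀ j ∈ J, h j ∈ H j) →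
    ∏ j ∈ J, h j = 1 → ∀ j ∈ J, h j = 1

end TopDyn

namespace TopDyn

open MeasureTheory Filter Topology

open scoped ComplexConjugate

/-! Orbits in the product are translates of the diagonal image of `T`, so minimality means that this
image is dense. A character of the product depends on finitely many coordinates
(`exists_finset_character_eq_one`), hence is a product of characters `χ j`; independence makes each
of them trivial if the product is trivial on the image. Since characters detect proper closed
subgroups (`exists_character_eq_one_on_of_isClosed`), the image is then dense. Conversely, density
extends a relation between the `χ j` from `T` to the whole product, where coordinates vary
separately.

The main work is that characters separate points of a compact abelian group. Translations `L a` and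
a convolution `C` lie in a commutative Banach algebra. The operator `(2 - L x - L x⁻¹) * C` is
nonzero and symmetric in L², hence not quasinilpotent, so a Gelfand character `ω` does not kill it;
`a ↦ ω (L a)` is then a character with value `≠ 1` at `x`. -/

/-! ### Spectral radius of symmetric operators -/

/-- In a closed commutative subalgebra of a complex Banach algebra, an element whose iterated
squares do not decay faster than geometrically is not annihilated by some character. -/
theorem exists_algHom_apply_ne_zero {A : Type*} [NormedRing A] [NormedAlgebra ℂ A]
    [CompleteSpace A] [NormOneClass A] (B : Subalgebra ℂ A) (hB : IsClosed (B : Set A))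
    (hcomm : ∀ a ∈ B, ∀ b ∈ B, a * b = b * a) (d : B) {c r : ℝ} (hc : 0 < c) (hr : 0 < r)
    (hd : ∀ k : ℕ, c * r ^ 2 ^ k ≤ ‖(d : A) ^ 2 ^ k‖) :
    ∃ ω : B →ₐ[ℂ] ℂ, Continuous ω ∧ (∀ b, ‖ω b‖ ≤ ‖b‖) ∧ ω d ≠ 0 := by
  let _ : NormedCommRing B :=
    { (inferInstance : NormedRing B) with
      mul_comm := fun a b => Subtype.ext (hcomm a a.2 b b.2) }
  have : CompleteSpace B := hB.completeSpace_coe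
  have : NormOneClass B := ⟨norm_one (α := A)⟩
  have hrad : 0 < spectralRadius ℂ d := by
    by_contra! hle
    have h0 : spectralRadius ℂ d = 0 := le_antisymm hle bot_le
    -- By Gelfand's formula, radius `0` forces `‖d ^ 2 ^ k‖ ≤ (r / 2) ^ 2 ^ k` for large `k`,
    -- against the lower bound once `(1 / 2) ^ 2 ^ k < c`.
    have ht := spectrum.pow_norm_pow_one_div_tendsto_nhds_spectralRadius d
    rw [h0] at ht
    have hev : ∀ᶠ n : ℕ in atTop, ENNReal.ofReal (‖d ^ n‖ ^ (1 / n : ℝ)) < ENNReal.ofReal (r / 2) :=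
      ht.eventually (gt_mem_nhds (by simpa using hr))
    have hpow : Tendsto (fun k : ℕ => 2 ^ k) atTop (atTop : Filter ℕ) :=
      tendsto_pow_atTop_atTop_of_one_lt one_lt_two
    have hlim : Tendsto (fun k : ℕ => (1 / 2 : ℝ) ^ 2 ^ k) atTop (𝓝 0) :=
      (tendsto_pow_atTop_nhds_zero_of_lt_one (by norm_num) (by norm_num)).comp hpow
    obtain ⟨k, hk1, hk2⟩ := ((hpow.eventually hev).and (hlim.eventually (gt_mem_nhds hc))).exists
    have hk3 : ‖d ^ 2 ^ k‖ ^ (1 / (2 ^ k : ℕ) : ℝ) < r / 2 :=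
      (ENNReal.ofReal_lt_ofReal_iff (by positivity)).1 hk1
    have hk4 : ‖d ^ 2 ^ k‖ ≤ (r / 2) ^ 2 ^ k := by
      have := pow_le_pow_left₀ (by positivity) hk3.le (2 ^ k)
      rwa [one_div, Real.rpow_inv_natCast_pow (norm_nonneg _) (by positivity)] at this
    have hk5 : c * r ^ 2 ^ k ≤ (r / 2) ^ 2 ^ k := (hd k).trans hk4
    have hk6 : (r / 2) ^ 2 ^ k = (1 / 2) ^ 2 ^ k * r ^ 2 ^ k := by
      rw [← mul_pow]; congr 1; ring
    rw [hk6] at hk5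
    exact absurd (le_of_mul_le_mul_right hk5 (by positivity)) (not_le.2 hk2)
  obtain ⟨z, hz, hzd⟩ : ∃ z ∈ spectrum ℂ d, z ≠ 0 := by
    by_contra! h
    refine hrad.ne' ?_
    rw [spectralRadius]
    simp only [ENNReal.iSup_eq_zero]
    intro z hz
    simp [h z hz]
  obtain ⟨f, hf⟩ := WeakDual.CharacterSpace.mem_spectrum_iff_exists.1 hz
  refine ⟨WeakDual.CharacterSpace.toAlgHom f, map_continuous f,
    fun b => AlgHom.norm_apply_le_self (WeakDual.CharacterSpace.toAlgHom f) b, ?_⟩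
  exact fun h => hzd (hf.symm.trans h)

/-- The iterated squares of an operator that is symmetric for a (possibly weaker) inner product
norm do not decay faster than geometrically. -/
theorem exists_le_norm_pow_two_pow {V H : Type*} [NormedAddCommGroup V] [NormedSpace ℂ V]
    [NormedAddCommGroup H] [InnerProductSpace ℂ H] (E : V →L[ℂ] H) (D : V →L[ℂ] V)
    (hD : ∀ u v, inner ℂ (E (D u)) (E v) = inner ℂ (E u) (E (D v))) {u : V} (hu : E (D u) ≠ 0) :
    ∃ c r : ℝ, 0 < c ∧ 0 < r ∧ ∀ k : ℕ, c * r ^ 2 ^ k ≤ ‖D ^ 2 ^ k‖ := by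
  have hDn : ∀ (n : ℕ) (u v : V),
      inner ℂ (E ((D ^ n) u)) (E v) = inner ℂ (E u) (E ((D ^ n) v)) := by
    intro n
    induction n with
    | zero => intro u v; simp
    | succ n ih =>
      intro u v
      rw [pow_succ, mul_apply_eq_comp, ih, hD, ← mul_apply_eq_comp,
        ← pow_succ', pow_succ]
  -- Symmetry moves `D ^ n` across the inner product, then Cauchy–Schwarz applies; iterating along
  -- `n = 2 ^ k` gives `hk`.
  have hsq : ∀ n : ℕ, ‖E ((D ^ n) u)‖ ^ 2 ≤ ‖E u‖ * ‖E ((D ^ (n * 2)) u)‖ := by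
    intro n
    have h1 : inner ℂ (E ((D ^ n) u)) (E ((D ^ n) u)) = inner ℂ (E u) (E ((D ^ (n * 2)) u)) := by
      rw [hDn, mul_two, pow_add, mul_apply_eq_comp]
    have h2 : ‖inner ℂ (E ((D ^ n) u)) (E ((D ^ n) u))‖ = ‖E ((D ^ n) u)‖ ^ 2 := by
      rw [inner_self_eq_norm_sq_to_K]; simp
    rw [← h2, h1]
    exact norm_inner_le_norm _ _
  have hb0 : 0 < ‖E (D u)‖ := norm_pos_iff.2 hu
  have hM : 0 < ‖E u‖ := by
    refine norm_pos_iff.2 fun h => ?_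
    have := hsq 1
    rw [h, norm_zero, zero_mul, pow_one] at this
    nlinarith
  have hk : ∀ k : ℕ, ‖E u‖ * (‖E (D u)‖ / ‖E u‖) ^ 2 ^ k ≤ ‖E ((D ^ 2 ^ k) u)‖ := by
    intro k
    induction k with
    | zero => simp [mul_div_cancel₀ _ hM.ne']
    | succ k ih =>
      have h1 := (pow_le_pow_left₀ (by positivity) ih 2).trans (hsq (2 ^ k))
      rw [mul_pow, ← pow_mul, ← pow_succ, sq, mul_assoc] at h1
      exact le_of_mul_le_mul_left h1 hM
  have hE : 0 < ‖E‖ := norm_pos_iff.2 fun h => hu (by simp [h])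
  have hV : 0 < ‖u‖ := norm_pos_iff.2 fun h => hu (by simp [h])
  refine ⟨‖E u‖ / (‖E‖ * ‖u‖), ‖E (D u)‖ / ‖E u‖, by positivity, by positivity, fun k => ?_⟩
  rw [div_mul_eq_mul_div, div_le_iff₀ (by positivity)]
  calc _ ≤ ‖E ((D ^ 2 ^ k) u)‖ := hk k
    _ ≤ ‖E‖ * (‖D ^ 2 ^ k‖ * ‖u‖) :=
      (E.le_opNorm _).trans (by gcongr; exact (D ^ 2 ^ k).le_opNorm u)
    _ = _ := by ring

/-! ### Integral operators with continuous kernel -/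

section IntegralOperator

variable {X : Type*} [TopologicalSpace X] [CompactSpace X] [MeasurableSpace X] [BorelSpace X]
  (μ : Measure X) [IsFiniteMeasure μ]

theorem _root_.ContinuousMap.integrable_of_compactSpace (f : C(X, ℂ)) : Integrable f μ :=
  f.continuous.integrable_of_hasCompactSupport (HasCompactSupport.of_compactSpace _)

/-- The integral of continuous functions on a compact space, as a continuous linear form. -/
noncomputable def integralForm : C(X, ℂ) →L[ℂ] ℂ :=
  LinearMap.mkContinuous
    { toFun := fun f => ∫ x, f x ∂μ
      map_add' := fun f g =>
        integral_add (f.integrable_of_compactSpace μ) (g.integrable_of_compactSpace μ)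
      map_smul' := fun c f => integral_const_mul c f } (μ.real Set.univ) fun f => by
    rw [mul_comm]
    exact norm_integral_le_of_norm_le_const (Eventually.of_forall f.norm_coe_le_norm)

/-- The integral operator with a continuous kernel. -/
noncomputable def integralOperator : C(X, C(X, ℂ)) →L[ℂ] C(X, ℂ) →L[ℂ] C(X, ℂ) :=
  LinearMap.mkContinuous₂
    (LinearMap.mk₂ ℂ
      (fun k u => ⟨fun x => integralForm μ (k x * u), by fun_prop⟩)
      (fun k k' u => by ext x; simp [add_mul])
      (fun c k u => by ext x; simp)
      (fun k u u' => by ext x; simp [mul_add])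
      (fun c k u => by ext x; simp)) ‖integralForm μ‖ fun k u => by
    refine (ContinuousMap.norm_le _ (by positivity)).2 fun x => ?_
    refine ((integralForm μ).le_opNorm _).trans ?_
    rw [mul_assoc]
    gcongr
    exact (norm_mul_le _ _).trans (by gcongr; exact k.norm_coe_le_norm x)

theorem integralOperator_apply (k : C(X, C(X, ℂ))) (u : C(X, ℂ)) (x : X) :
    integralOperator μ k u x = ∫ y, k x y * u y ∂μ :=
  rfl

variable [T2Space X] in
/-- An integral operator with a Hermitian kernel is symmetric. -/
theorem inner_integralOperator (k : C(X, C(X, ℂ))) (hk : ∀ x y, conj (k x y) = k y x)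
    (u v : C(X, ℂ)) :
    inner ℂ (ContinuousMap.toLp 2 μ ℂ (integralOperator μ k u)) (ContinuousMap.toLp 2 μ ℂ v) =
      inner ℂ (ContinuousMap.toLp 2 μ ℂ u)
        (ContinuousMap.toLp 2 μ ℂ (integralOperator μ k v)) := by
  rw [ContinuousMap.inner_toLp, ContinuousMap.inner_toLp]
  simp only [integralOperator_apply, ← integral_conj, ← integral_const_mul, ← integral_mul_const]
  -- This form of Fubini needs no second countability of `X`.
  rw [integral_integral_swap_of_hasCompactSupport _ (HasCompactSupport.of_compactSpace _)]
  · refine integral_congr_ae (Eventually.of_forall fun y => ?_)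
    refine integral_congr_ae (Eventually.of_forall fun x => ?_)
    simp only [map_mul, hk]
    ring
  · have : Continuous fun p : X × X => k p.1 p.2 := ContinuousMap.continuous_uncurry_of_continuous k
    simp only [Function.uncurry_def]
    fun_prop

end IntegralOperator

/-! ### Translations and convolutions on a compact abelian group -/

section Translation

variable {G : Type*} [CommGroup G] [TopologicalSpace G] [IsTopologicalGroup G]

/-- The convolution kernel `k (y⁻¹ x)` of a continuous function `k` on a group. -/
noncomputable def convolutionKernel (k : C(G, ℂ)) : C(G, C(G, ℂ)) :=
  ContinuousMap.curry ⟨fun p => k (p.2⁻¹ * p.1), by fun_prop⟩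

theorem convolutionKernel_apply (k : C(G, ℂ)) (x y : G) :
    convolutionKernel k x y = k (y⁻¹ * x) :=
  rfl

variable [CompactSpace G]

/-- Left translation of continuous functions on a compact group. -/
noncomputable def translation (a : G) : C(G, ℂ) →L[ℂ] C(G, ℂ) :=
  LinearMap.mkContinuous
    { toFun := fun u => ⟨fun y => u (a⁻¹ * y), by fun_prop⟩
      map_add' := fun _ _ => rfl
      map_smul' := fun _ _ => rfl } 1 fun u => by
    rw [one_mul]
    exact (ContinuousMap.norm_le _ (norm_nonneg _)).2 fun x => u.norm_coe_le_norm _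

theorem translation_apply (a : G) (u : C(G, ℂ)) (y : G) : translation a u y = u (a⁻¹ * y) :=
  rfl

theorem norm_translation_le (a : G) : ‖translation a‖ ≤ 1 :=
  LinearMap.mkContinuous_norm_le _ zero_le_one _

theorem translation_one : translation (1 : G) = 1 := by
  ext u y
  simp [translation_apply]

theorem translation_mul (a b : G) : translation (a * b) = translation a * translation b := by
  ext u y
  simp [translation_apply, mul_assoc, mul_comm b⁻¹]

variable [MeasurableSpace G] [BorelSpace G] (μ : Measure G) [IsFiniteMeasure μ]

/-- The operator of convolution by a continuous function on a compact group. -/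
noncomputable def convolution (k : C(G, ℂ)) : C(G, ℂ) →L[ℂ] C(G, ℂ) :=
  integralOperator μ (convolutionKernel k)

theorem convolution_apply (k u : C(G, ℂ)) (x : G) :
    convolution μ k u x = ∫ y, k (y⁻¹ * x) * u y ∂μ :=
  rfl

theorem translation_mul_convolution (a : G) (k : C(G, ℂ)) :
    translation a * convolution μ k = convolution μ (translation a k) := by
  ext u x
  simp [translation_apply, convolution_apply, mul_left_comm]

theorem commute_translation_convolution [μ.IsMulLeftInvariant] (a : G) (k : C(G, ℂ)) :
    Commute (translation a) (convolution μ k) := by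
  ext u x
  simp only [mul_apply_eq_comp, translation_apply, convolution_apply]
  rw [← integral_mul_left_eq_self (fun y => k (y⁻¹ * x) * u (a⁻¹ * y)) a]
  simp [mul_assoc, mul_comm]

/-- Convolution turns translation into a norm-continuous family, although `translation` itself is in
general only strongly continuous. This makes `a ↦ ω (L a)` continuous. -/
theorem continuous_convolution_translation (k : C(G, ℂ)) :
    Continuous fun a => convolution μ (translation a k) := by
  refine (integralOperator μ).continuous.comp ?_
  refine ContinuousMap.continuous_of_continuous_uncurry _ ?_
  refine ContinuousMap.continuous_of_continuous_uncurry _ ?_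
  simp only [Function.uncurry_def, convolutionKernel_apply, translation_apply]
  fun_prop

theorem convolution_sub (k k' : C(G, ℂ)) :
    convolution μ (k - k') = convolution μ k - convolution μ k' := by
  have : convolutionKernel (k - k') = convolutionKernel k - convolutionKernel k' := rfl
  rw [convolution, this, map_sub]
  rfl

theorem convolution_add (k k' : C(G, ℂ)) :
    convolution μ (k + k') = convolution μ k + convolution μ k' := by
  have : convolutionKernel (k + k') = convolutionKernel k + convolutionKernel k' := rfl
  rw [convolution, this, map_add]
  rfl

/-- A closed commutative algebra of operators containing the translations and one convolution. -/
theorem exists_subalgebra_translation_convolution [μ.IsMulLeftInvariant] (k : C(G, ℂ)) :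
    ∃ B : Subalgebra ℂ (C(G, ℂ) →L[ℂ] C(G, ℂ)), IsClosed (B : Set (C(G, ℂ) →L[ℂ] C(G, ℂ))) ∧
      (∀ a ∈ B, ∀ b ∈ B, a * b = b * a) ∧ (∀ a, translation a ∈ B) ∧ convolution μ k ∈ B := by
  set S : Set (C(G, ℂ) →L[ℂ] C(G, ℂ)) := insert (convolution μ k) (Set.range translation) with hS
  have hc : S ⊆ Set.centralizer S := by
    rintro _ (rfl | ⟨a, rfl⟩) _ (rfl | ⟨b, rfl⟩)
    · rfl
    · exact commute_translation_convolution μ b k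
    · exact (commute_translation_convolution μ a k).symm
    · rw [← translation_mul, ← translation_mul, mul_comm]
  -- The bicommutant of a commuting set is closed and commutative.
  refine ⟨Subalgebra.centralizer ℂ (Set.centralizer S), Set.isClosed_centralizer _, ?_, ?_, ?_⟩
  · intro a ha b hb
    exact hb a (Set.centralizer_subset hc ha)
  · exact fun a => Set.subset_centralizer_centralizer (Set.mem_insert_of_mem _ ⟨a, rfl⟩)
  · exact Set.subset_centralizer_centralizer (Set.mem_insert _ _)

end Translation

/-! ### Characters separate points and closed subgroups -/

section Characters

/-- A continuous homomorphism from a group to the closed unit disc is a character. -/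
theorem exists_character_of_norm_le_one {G : Type*} [Group G] [TopologicalSpace G]
    (χ : G →* ℂ) (hc : Continuous χ) (h1 : ∀ a, ‖χ a‖ ≤ 1) :
    ∃ ψ : G →ₜ* Circle, ∀ a, (ψ a : ℂ) = χ a := by
  have hn : ∀ a, ‖χ a‖ = 1 := fun a => by
    refine le_antisymm (h1 a) ?_
    have h2 : ‖χ a‖ * ‖χ a⁻¹‖ = 1 := by rw [← norm_mul, ← map_mul]; simp
    nlinarith [h1 a⁻¹, norm_nonneg (χ a)]
  refine ⟨⟨⟨⟨fun a => ⟨χ a, mem_sphere_zero_iff_norm.2 (hn a)⟩, ?_⟩, ?_⟩, ?_⟩, fun a => rfl⟩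
  · exact Circle.ext (by simp)
  · exact fun a b => Circle.ext (map_mul χ a b)
  · exact hc.subtype_mk _

variable {G : Type*} [CommGroup G] [TopologicalSpace G] [IsTopologicalGroup G] [CompactSpace G]

section Hausdorff

variable [T2Space G]

/-- An even continuous function that takes the value `2` at the identity and vanishes at a given
point. -/
theorem exists_even_bump {x : G} (hx : x ≠ 1) :
    ∃ h : C(G, ℝ), (∀ y, h y⁻¹ = h y) ∧ h 1 = 2 ∧ h x = 0 := by
  have hd : Disjoint ({x, x⁻¹} : Set G) {1} := by simp [hx, eq_comm]
  obtain ⟨f, hf0, hf1, -⟩ := exists_continuous_zero_one_of_isClosed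
    (Set.toFinite {x, x⁻¹}).isClosed isClosed_singleton hd
  refine ⟨⟨fun y => f y + f y⁻¹, by fun_prop⟩, fun y => ?_, ?_, ?_⟩
  · simp [add_comm]
  · have : f 1 = 1 := hf1 rfl
    simp [this]
    norm_num
  · have h1 : f x = 0 := hf0 (by simp)
    have h2 : f x⁻¹ = 0 := hf0 (by simp)
    simp [h1, h2]

/-- The continuous characters of a compact Hausdorff abelian group separate points. -/
theorem exists_character_apply_ne_one {x : G} (hx : x ≠ 1) : ∃ ψ : G →ₜ* Circle, ψ x ≠ 1 := by
  borelize G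
  let μ : Measure G := Measure.haar
  obtain ⟨h, heven, h1, hx0⟩ := exists_even_bump hx
  let hh : C(G, ℂ) := ⟨fun y => (h y : ℂ), by fun_prop⟩
  obtain ⟨B, hBc, hBcomm, hBt, hBk⟩ := exists_subalgebra_translation_convolution μ hh
  -- The symmetric second difference of `h` is even, which makes the kernel Hermitian, and equals
  -- `4` at the identity.
  let kr : C(G, ℝ) := ⟨fun y => 2 * h y - h (x⁻¹ * y) - h (x * y), by fun_prop⟩
  let k : C(G, ℂ) := ⟨fun y => (kr y : ℂ), by fun_prop⟩
  have hkeven : ∀ y, kr y⁻¹ = kr y := fun y => by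
    have e1 : h (x⁻¹ * y⁻¹) = h (x * y) := by rw [← heven]; simp [mul_comm]
    have e2 : h (x * y⁻¹) = h (x⁻¹ * y) := by rw [← heven]; simp [mul_comm]
    simp only [kr, ContinuousMap.coe_mk, heven, e1, e2]
    ring
  have hk1 : kr 1 ≠ 0 := by
    simp [kr, heven, h1, hx0]
  let L : G → B := fun a => ⟨translation a, hBt a⟩
  let C : B := ⟨convolution μ hh, hBk⟩
  let d : B := (2 - L x - L x⁻¹) * C
  have hdk : (d : C(G, ℂ) →L[ℂ] C(G, ℂ)) = convolution μ k := by
    have e : k = (hh + hh) - translation x hh - translation x⁻¹ hh := by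
      ext y
      simp [k, kr, hh, translation_apply, two_mul]
    rw [e, convolution_sub, convolution_sub, convolution_add, ← translation_mul_convolution,
      ← translation_mul_convolution]
    change (2 - translation x - translation x⁻¹) * convolution μ hh = _
    rw [sub_mul, sub_mul, two_mul]
  -- By evenness, the value of `d k` at the identity is the integral of `kr ^ 2`, which is positive.
  have hne : ContinuousMap.toLp 2 μ ℂ ((d : C(G, ℂ) →L[ℂ] C(G, ℂ)) k) ≠ 0 := by
    intro h0
    have h2 := congrArg (fun f : C(G, ℂ) => f 1)
      (ContinuousMap.toLp_injective μ (p := 2) (𝕜 := ℂ) (h0.trans (map_zero _).symm))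
    have h3 : ∫ y, kr y * kr y ∂μ = 0 := by
      rw [hdk] at h2
      simp only [convolution_apply, mul_one, ContinuousMap.zero_apply] at h2
      have : ∀ y, k y⁻¹ * k y = ((kr y * kr y : ℝ) : ℂ) := fun y => by
        simp [k, hkeven]
      simp only [this] at h2
      rw [integral_complex_ofReal] at h2
      exact_mod_cast h2
    have hpos : 0 < ∫ y, kr y * kr y ∂μ :=
      (by fun_prop : Continuous fun y => kr y * kr y).integral_pos_of_hasCompactSupport_nonneg_nonzero
        (HasCompactSupport.of_compactSpace _) (fun y => mul_self_nonneg _)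
        (x := 1) (mul_self_ne_zero.2 hk1)
    exact hpos.ne' h3
  obtain ⟨c, r, hc, hr, hcr⟩ := exists_le_norm_pow_two_pow (ContinuousMap.toLp 2 μ ℂ)
    (d : C(G, ℂ) →L[ℂ] C(G, ℂ)) (by
      rw [hdk]
      refine inner_integralOperator μ _ fun a b => ?_
      have : kr (a⁻¹ * b) = kr (b⁻¹ * a) := by rw [← hkeven]; simp
      simp [convolutionKernel_apply, k, this]) hne
  obtain ⟨ω, hωc, hωn, hωd⟩ := exists_algHom_apply_ne_zero
    (A := C(G, ℂ) →L[ℂ] C(G, ℂ)) B hBc hBcomm d hc hr hcr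
  have hωd' : (2 - ω (L x) - ω (L x⁻¹)) * ω C ≠ 0 := by
    simpa only [d, map_mul, map_sub, map_ofNat] using hωd
  let χ : G →* ℂ :=
    { toFun := fun a => ω (L a)
      map_one' := by
        have : L 1 = 1 := Subtype.ext translation_one
        simp [this]
      map_mul' := fun a b => by
        have : L (a * b) = L a * L b := Subtype.ext (translation_mul a b)
        simp [this] }
  have hχc : Continuous χ := by
    -- Dividing by `ω C ≠ 0` reduces continuity to that of `a ↦ L a * C`.
    have e : ∀ a, χ a = ω (L a * C) / ω C := fun a => by
      rw [map_mul, mul_div_cancel_right₀ _ (right_ne_zero_of_mul hωd')]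
      rfl
    have hcont : Continuous fun a => L a * C := by
      refine Continuous.subtype_mk (p := (· ∈ B)) (f := fun a => translation a * convolution μ hh) ?_
        (fun a => B.mul_mem (hBt a) hBk)
      simp only [translation_mul_convolution]
      exact continuous_convolution_translation μ hh
    rw [funext e]
    exact (hωc.comp hcont).div_const _
  obtain ⟨ψ, hψ⟩ := exists_character_of_norm_le_one χ hχc
    fun a => (hωn _).trans (norm_translation_le a)
  -- If `ψ x = 1`, the factor `2 - ω (L x) - ω (L x⁻¹)` is `2 - 1 - 1 = 0`.
  refine ⟨ψ, fun hψx => left_ne_zero_of_mul hωd' ?_⟩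
  have e1 : ω (L x) = 1 := by
    have := hψ x
    rw [hψx] at this
    exact this.symm
  have e2 : ω (L x⁻¹) = 1 := by
    have := hψ x⁻¹
    rw [map_inv, hψx, inv_one] at this
    exact this.symm
  rw [e1, e2]
  norm_num

end Hausdorff

/-- A proper closed subgroup of a compact abelian group is annihilated by a non-trivial
continuous character. -/
theorem exists_character_eq_one_on_of_isClosed {H : Subgroup G} (hH : IsClosed (H : Set G)) {x : G}
    (hx : x ∉ H) : ∃ ψ : G →ₜ* Circle, (∀ y ∈ H, ψ y = 1) ∧ ψ x ≠ 1 := by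
  have : IsClosed (H : Set G) := hH
  obtain ⟨ψ, hψ⟩ := exists_character_apply_ne_one (G := G ⧸ H) (x := (x : G ⧸ H))
    (fun h => hx ((QuotientGroup.eq_one_iff x).1 h))
  refine ⟨ψ.comp ⟨QuotientGroup.mk' H, QuotientGroup.continuous_mk⟩, fun y hy => ?_, hψ⟩
  have : (QuotientGroup.mk' H y) = 1 := (QuotientGroup.eq_one_iff y).2 hy
  change ψ (QuotientGroup.mk' H y) = 1
  rw [this, map_one]

end Characters

/-! ### Products of compactifications and their characters -/

/-- A continuous character of a product of groups depends on finitely many coordinates. -/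
theorem exists_finset_character_eq_one {I : Type*} {X : I → Type*} [∀ i, Group (X i)]
    [∀ i, TopologicalSpace (X i)] (ψ : (∀ i, X i) →ₜ* Circle) :
    ∃ J : Finset I, ∀ x : ∀ i, X i, (∀ j ∈ J, x j = 1) → ψ x = 1 := by
  have hU : ψ ⁻¹' Circle.centeredArc (Real.pi / 2) ∈ 𝓝 (1 : ∀ i, X i) := by
    refine (map_continuous ψ).continuousAt.preimage_mem_nhds ?_
    rw [map_one]
    refine (Circle.isOpen_centeredArc _).mem_nhds ?_
    rw [Circle.mem_centeredArc (by linarith [Real.pi_pos])]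
    simp [Real.pi_pos]
  rw [nhds_pi, Filter.mem_pi] at hU
  obtain ⟨J, hJ, t, ht, hsub⟩ := hU
  refine ⟨hJ.toFinset, fun x hx => ?_⟩
  -- The circle has no small subgroups: all powers of `x` stay in the basic neighbourhood, since its
  -- coordinates in `J` are trivial.
  refine Circle.eq_one_of_forall_pow_mem_centeredArc_pi_div_two fun n hn => ?_
  rw [← map_pow]
  refine hsub fun j hj => ?_
  rw [Pi.pow_apply, hx j (hJ.mem_toFinset.2 hj), one_pow]
  exact mem_of_mem_nhds (ht j)

namespace GroupCompactification

variable {T : Type u} [CommGroup T] [TopologicalSpace T]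

/-- Commutation with the dense image of `T` extends by continuity, one variable at a time. -/
theorem mul_comm_of_commGroup (K : GroupCompactification.{u, v} T) (x y : K.carrier) :
    x * y = y * x := by
  have h1 : ∀ s y, K.hom s * y = y * K.hom s := fun s => by
    refine congrFun (K.dense.equalizer (continuous_const_mul _) (continuous_mul_const _)
      (funext fun t => ?_))
    simp only [Function.comp_apply, ← map_mul, mul_comm]
  exact congrFun (K.dense.equalizer (continuous_mul_const y) (continuous_const_mul y)
    (funext fun s => h1 s y)) x

theorem character_eq_one (K : GroupCompactification.{u, v} T) (χ : K.carrier →ₜ* Circle)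
    (h : ∀ t, χ (K.hom t) = 1) (x : K.carrier) : χ x = 1 :=
  congrFun (K.dense.equalizer (map_continuous χ) continuous_const (funext h)) x

end GroupCompactification

theorem map_eq_map_piecewise_mul_prod {I : Type*} [DecidableEq I] {X : I → Type*}
    [∀ i, Monoid (X i)] {M F : Type*} [CommMonoid M] [FunLike F (∀ i, X i) M]
    [MonoidHomClass F (∀ i, X i) M] (ψ : F) (J : Finset I) (x : ∀ i, X i) :
    ψ x = ψ (J.piecewise 1 x) * ∏ j ∈ J, ψ (Pi.mulSingle j (x j)) := by
  induction J using Finset.induction_on with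
  | empty => simp
  | insert a J ha ih =>
    have e : J.piecewise (1 : ∀ i, X i) x = (insert a J).piecewise (1 : ∀ i, X i) x * Pi.mulSingle a (x a) := by
      funext i
      by_cases hi : i = a
      · subst hi
        simp [ha]
      · by_cases hJ : i ∈ J <;> simp [hi, hJ]
    rw [Finset.prod_insert ha, ← mul_assoc, ← map_mul, ← e, ih]

/-- Evaluation of characters at a point. -/
noncomputable def evalCharacter {A : Type*} [Monoid A] [TopologicalSpace A] (a : A) :
    PontryaginDual A →* Circle where
  toFun χ := χ a
  map_one' := rfl
  map_mul' _ _ := rfl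

theorem prod_character_apply {A ι : Type*} [Monoid A] [TopologicalSpace A] (J : Finset ι)
    (h : ι → PontryaginDual A) (a : A) : (∏ j ∈ J, h j) a = ∏ j ∈ J, h j a :=
  map_prod (evalCharacter a) h J

section Family

variable {T : Type u} [CommGroup T] [TopologicalSpace T] {I : Type w}
  (K : I → GroupCompactification.{u, v} T)

theorem multiplyDisjoint_iff_denseRange :
    MultiplyDisjoint T (fun i => (K i).carrier) ↔ DenseRange fun t i => (K i).hom t := by
  constructor
  · intro h
    have h1 := h.dense_orbit 1
    have e : MulAction.orbit T (1 : ∀ i, (K i).carrier) = Set.range fun t i => (K i).hom t := by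
      refine congrArg Set.range (funext fun t => funext fun i => ?_)
      exact mul_one _
    rwa [e] at h1
  · exact fun h => ⟨fun x =>
      (mul_right_surjective x).denseRange.comp h (continuous_mul_const x)⟩

/-- If only the trivial character of the product is trivial on the image of `T`, that image is
dense. -/
theorem denseRange_of_forall_character
    (h : ∀ ψ : (∀ i, (K i).carrier) →ₜ* Circle, (∀ t, ψ (fun i => (K i).hom t) = 1) →
      ∀ x, ψ x = 1) :
    DenseRange fun t i => (K i).hom t := by
  let _ : CommGroup (∀ i, (K i).carrier) :=
    { (inferInstance : Group (∀ i, (K i).carrier)) with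
      mul_comm := fun x y => funext fun i => (K i).mul_comm_of_commGroup (x i) (y i) }
  let f : T →* ∀ i, (K i).carrier := MonoidHom.pi fun i => ((K i).hom : T →* (K i).carrier)
  intro x
  by_contra hx
  obtain ⟨ψ, hψ, hψx⟩ := exists_character_eq_one_on_of_isClosed
    (H := f.range.topologicalClosure) f.range.isClosed_topologicalClosure (x := x) hx
  exact hψx (h ψ (fun t => hψ _ (f.range.le_topologicalClosure ⟨t, rfl⟩)) x)

end Family

end TopDyn

theorem mainTheorem6 {T : Type u} [CommGroup T] [TopologicalSpace T]
    [IsTopologicalGroup T] {I : Type w} (K : I → TopDyn.GroupCompactification.{u, v} T) :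
    TopDyn.MultiplyDisjoint T (fun i => (K i).carrier) ↔
      TopDyn.IndependentSubgroups (fun i => (K i).characters) := by
  classical
  rw [TopDyn.multiplyDisjoint_iff_denseRange]
  constructor
  · intro hd J _ h hmem hprod j hj
    choose! χ hχ using hmem
    have hχt : ∀ i ∈ J, ∀ t, h i t = χ i ((K i).hom t) := fun i hi t => by
      rw [← hχ i hi]; rfl
    have hprodt : ∀ t, ∏ i ∈ J, χ i ((K i).hom t) = 1 := fun t => by
      rw [← Finset.prod_congr rfl fun i hi => hχt i hi t, ← TopDyn.prod_character_apply, hprod]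
      rfl
    have hall : ∀ x : ∀ i, (K i).carrier, ∏ i ∈ J, χ i (x i) = 1 := by
      have hc : Continuous fun x : ∀ i, (K i).carrier => ∏ i ∈ J, χ i (x i) :=
        continuous_finsetProd _ fun i _ => (map_continuous (χ i)).comp (continuous_apply i)
      exact congrFun (hd.equalizer hc (continuous_const (y := (1 : Circle))) (funext hprodt))
    refine PontryaginDual.ext fun t => ?_
    -- A point supported at the coordinate `j` isolates the factor `h j t`.
    have := hall (Pi.mulSingle j ((K j).hom t))
    rw [Finset.prod_eq_single_of_mem j hj] at this
    · rw [hχt j hj, PontryaginDual.one_apply, ← this, Pi.mulSingle_eq_same]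
    · intro i _ hij
      rw [Pi.mulSingle_eq_of_ne hij, map_one]
  · intro hind
    refine TopDyn.denseRange_of_forall_character K fun ψ hψ => ?_
    obtain ⟨J, hJ⟩ := TopDyn.exists_finset_character_eq_one ψ
    let χ : ∀ i, (K i).carrier →ₜ* Circle := fun i =>
      ψ.comp ⟨MonoidHom.mulSingle (fun i => (K i).carrier) i,
        continuous_mulSingle (A := fun i => (K i).carrier) i⟩
    have hprod : ∀ x : ∀ i, (K i).carrier, ψ x = ∏ j ∈ J, χ j (x j) := fun x => by
      rw [TopDyn.map_eq_map_piecewise_mul_prod ψ J x, hJ _ (fun j hj => by simp [hj]), one_mul]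
      rfl
    have hχ : ∀ j ∈ J, ∀ x, χ j x = 1 := fun j hj => by
      refine (K j).character_eq_one (χ j) fun t => ?_
      -- The restrictions of `χ j` to `T` multiply to `ψ` on the diagonal image, which is trivial by
      -- `hψ`.
      have h1 := hind J ⟨j, hj⟩ (fun i => PontryaginDual.map (K i).hom (χ i))
        (fun i _ => ⟨χ i, rfl⟩) (PontryaginDual.ext fun t => by
          rw [TopDyn.prod_character_apply]
          exact (hprod _).symm.trans (hψ t)) j hj
      exact congrArg (fun f : PontryaginDual T => f t) h1
    intro x
    rw [hprod, Finset.prod_eq_one fun j hj => hχ j hj (x j)]
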